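/- Let $S$ and $A$ be Polish spaces with their Borel $\sigma$-algebras, $P$ a Markov kernel from $S\times A$ to $S$, $c:S\times A\to\mathbb R$ bounded and measurable, $\gamma\in(0,1)$, $\mu$ a probability measure on $A$ and $\tau>0$. For a policy $\pi$ (a Markov kernel from $S$ to $A$) put $P^\pi(ds',da'|s,a)=P(ds'|s,a)\,\pi(da'|s')$ and $P_\pi(ds'|s)=\int_A P(ds'|s,a)\,\pi(da|s)$, and define $$V^\pi_\tau(s)=\mathbb E^\pi_s\Big[\sum_{n\ge0}\gamma^n\big(c(s_n,a_n)+\tau\,\mathrm{KL}(\pi(\cdot|s_n)|\mu)\big)\Big],\qquad Q^\pi_\tau(s,a)=c(s,a)+\gamma\int_S V^\pi_\tau(s')\,P(ds'|s,a).$$ Let $\Pi_\mu$ be the set of policies of the form $\pi(da|s)=e^{f(s,a)}\mu(da)/\int_A e^{f(s,a')}\mu(da')$ with $f$ bounded and measurable. Let $\phi:S\times A\to\mathbb R^N$ be measurable, $Q(s,a;\theta)=\langle\theta,\phi(s,a)\rangle$, let $\beta$ be a probability measure on $S\times A$ and $\rho$ a probability measure on $S$ (for instance the marginal of $\beta$).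 Put $d^\pi_\beta=(1-\gamma)\sum_{n\ge0}\gamma^n\beta (P^\pi)^n$, $d^\pi_\rho=(1-\gamma)\sum_{n\ge0}\gamma^n\rho P_\pi^n$, and $$\mathrm T^\pi_\tau f(s,a)=c(s,a)+\gamma\int f\,dP^\pi(\cdot|s,a)+\tau\gamma\int_S\mathrm{KL}(\pi(\cdot|s')|\mu)\,P(ds'|s,a),$$ $$g(\theta,\pi)=\int_{S\times A}\big(Q(s,a;\theta)-\mathrm T^\pi_\tau Q(\cdot;\theta)(s,a)\big)\phi(s,a)\,d^\pi_\beta(ds,da),$$ $$A(s,a;\theta,\pi)=Q(s,a;\theta)+\tau\ln\tfrac{d\pi}{d\mu}(s,a)-\int_A\Big(Q(s,a';\theta)+\tau\ln\tfrac{d\pi}{d\mu}(s,a')\Big)\pi(da'|s).$$ Assume that 1. $\lambda_\beta:=\lambda_{\min}\big(\int\phi\phi^\top d\beta\big)>0$; 2. $|\phi(s,a)|_2\le1$ for all $(s,a)$; 3. for every $\pi\in\Pi_\mu$ there is $\theta_\pi\in\mathbb R^N$ with $Q^\pi_\tau(s,a)=\langle\theta_\pi,\phi(s,a)\rangle$ for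 all $(s,a)$. Put $\Gamma=(1-\gamma)(1-\sqrt\gamma)\lambda_\beta$. Let $0<h<\min\{\Gamma/(2(1+\gamma)),\,1/\Gamma\}$ and $0<\tau\lambda<1$, let $\kappa>0$, and let the integers $M(n)\ge1$ satisfy $$M(n)\ \ge\ \frac{4}{h\Gamma}\log\big(\kappa(n+1)\big)\qquad\text{for all } n\ge0.$$ Let $\theta^0\in\mathbb R^N$, $\pi^0\in\Pi_\mu$, and let $(\theta^n,\pi^n)_{n\ge0}$ be generated by the double loop actor-critic algorithm: for each $n\ge0$, starting from $\theta^{n,0}=\theta^n$, set $\theta^{n,k}=\theta^{n,k-1}-h\,g(\theta^{n,k-1},\pi^n)$ for $k=1,\dots,M(n)$, then $\theta^{n+1}=\theta^{n,M(n)}$, and let $\pi^{n+1}\in\Pi_\mu$ be the minimiser over $\pi\in\Pi_\mu$ of $$\tilde G(\pi,\pi^n,\theta^{n+1})=\int_S\Big(\int_A A(s,a;\theta^{n+1},\pi^n)\,\pi(da|s)+\frac1\lambda\mathrm{KL}(\pi(\cdot|s)|\pi^n(\cdot|s))\Big)d^{\pi^n}_\rho(ds),$$ in the version for which $\pi^{n+1}$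 minimises the integrand (the large bracket) at every state $s\in S$. Then there exists $R\ge0$ such that for all $n\ge0$ and all $s\in S$ $$|\theta^n|_2+\mathrm{KL}(\pi^n(\cdot|s)|\mu)\le R.$$ -/

import Mathlib

open MeasureTheory ProbabilityTheory InformationTheory

namespace EntropyMDP

noncomputable section

/-- An entropy-regularised Markov decision process `(S, A, P, c, γ)` with a bounded measurable cost,
a reference probability measure `μ` on the actions and a regularisation parameter `τ > 0`. -/
structure MDP (S A : Type*) [MeasurableSpace S] [MeasurableSpace A] where
  /-- the transition kernel `P(ds' | s, a)` -/
  P : Kernel (S × A) S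
  isMarkov : IsMarkovKernel P
  cost : S × A → ℝ
  measurable_cost : Measurable cost
  bounded_cost : ∃ C : ℝ, ∀ x, |cost x| ≤ C
  /-- the discount factor -/
  γ : ℝ
  γ_pos : 0 < γ
  γ_lt_one : γ < 1
  /-- the reference measure on the action space -/
  μ : Measure A
  isProb : IsProbabilityMeasure μ
  /-- the regularisation parameter -/
  τ : ℝ
  τ_pos : 0 < τ

/-- Stochastic policies: the Markov kernels from states to actions. -/
abbrev Policy (S A : Type*) [MeasurableSpace S] [MeasurableSpace A] :=
  {π : Kernel S A // IsMarkovKernel π}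

/-- The Euclidean space `ℝ^N`. -/
abbrev Vec (N : ℕ) := EuclideanSpace ℝ (Fin N)

/-- The discounted occupancy measure `(1 - γ) ∑ₙ γⁿ ν κⁿ` of the Markov chain with transition
kernel `κ` and initial distribution `ν`. -/
def occupancy {X : Type*} [MeasurableSpace X] (γ : ℝ) (κ : Kernel X X) (ν : Measure X) :
    Measure X :=
  Measure.sum fun n : ℕ =>
    ENNReal.ofReal ((1 - γ) * γ ^ n) • (fun m : Measure X => m.bind κ)^[n] ν

/-- The smallest eigenvalue of a (symmetric) real matrix; the spectrum of a matrix is its set of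
eigenvalues. -/
def minEigenvalue {N : ℕ} (B : Matrix (Fin N) (Fin N) ℝ) : ℝ := sInf (spectrum ℝ B)

variable {S A : Type*} [MeasurableSpace S] [MeasurableSpace A]

instance (π : Policy S A) : IsMarkovKernel π.1 := π.2

instance (D : MDP S A) : IsMarkovKernel D.P := D.isMarkov

instance (D : MDP S A) : IsProbabilityMeasure D.μ := D.isProb

/-- The matrix `∫ φ φᵀ dβ`. -/
def featureCovariance {N : ℕ} (φ : S × A → Vec N) (β : Measure (S × A)) :
    Matrix (Fin N) (Fin N) ℝ :=
  Matrix.of fun i j => ∫ x, φ x i * φ x j ∂β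

/-- `Q(s, a; θ) = ⟨θ, φ(s, a)⟩`. -/
def linearQ {N : ℕ} (φ : S × A → Vec N) (θ : Vec N) (x : S × A) : ℝ := inner ℝ θ (φ x)

namespace MDP

variable (D : MDP S A)

/-- The class `Π_μ` of policies `π(da|s) = exp (f(s,a)) μ(da) / ∫ exp (f(s,a')) μ(da')` with
`f` bounded and measurable. -/
def admissible : Set (Policy S A) :=
  {π | ∃ f : S × A → ℝ, Measurable f ∧ (∃ C : ℝ, ∀ x, |f x| ≤ C) ∧
    ∀ s, π.1 s = D.μ.tilted fun a => f (s, a)}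

/-- The transition kernel `P^π(ds', da' | s, a) = P(ds' | s, a) π(da' | s')` of the state-action
chain. -/
def stateActionKernel (π : Policy S A) : Kernel (S × A) (S × A) :=
  D.P.compProd (Kernel.prodMkLeft (S × A) π.1)

instance (π : Policy S A) : IsMarkovKernel (D.stateActionKernel π) := by
  unfold stateActionKernel; infer_instance

/-- The transition kernel `P_π(ds' | s) = ∫ P(ds' | s, a) π(da | s)` of the state chain. -/
def stateKernel (π : Policy S A) : Kernel S S :=
  D.P.comp (Kernel.prod Kernel.id π.1)

/-- The law on `(S × A)^ℕ` of the trajectory `(s_n, a_n)` with `s_0 = s`, `a_n ∼ π(· | s_n)` and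
`s_{n+1} ∼ P(· | s_n, a_n)`. -/
def trajectory (π : Policy S A) (s : S) : Measure (ℕ → S × A) :=
  Kernel.trajMeasure (X := fun _ => S × A) ((Measure.dirac s).compProd π.1) fun n =>
    (D.stateActionKernel π).comap
      (fun x : (i : Finset.Iic n) → S × A => x ⟨n, Finset.mem_Iic.2 le_rfl⟩)
      (measurable_pi_apply _)

/-- The real number `KL(π(· | s) | μ)`; only used for policies for which it is finite. -/
def kl (π : Policy S A) (s : S) : ℝ := (klDiv (π.1 s) D.μ).toReal

/-- The regularised value function
`V^π_τ(s) = E_s^π [∑ₙ γⁿ (c(s_n, a_n) + τ KL(π(· | s_n) | μ))]`. -/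
def value (π : Policy S A) (s : S) : ℝ :=
  ∫ ω, ∑' n : ℕ, D.γ ^ n * (D.cost (ω n) + D.τ * D.kl π (ω n).1) ∂(D.trajectory π s)

/-- The state-action value function `Q^π_τ(s, a) = c(s, a) + γ ∫ V^π_τ(s') P(ds' | s, a)`. -/
def qValue (π : Policy S A) (x : S × A) : ℝ :=
  D.cost x + D.γ * ∫ s', D.value π s' ∂(D.P x)

/-- The Bellman operator `T^π_τ`. -/
def bellman (π : Policy S A) (f : S × A → ℝ) (x : S × A) : ℝ :=
  D.cost x + D.γ * ∫ y, f y ∂(D.stateActionKernel π x) + D.τ * D.γ * ∫ s', D.kl π s' ∂(D.P x)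

variable {N : ℕ} (φ : S × A → Vec N)

/-- The semi-gradient `g(θ, π)` of the mean squared Bellman error,
`∫ (Q(s,a;θ) - T^π_τ Q(s,a;θ)) φ(s,a) d^π_β(ds,da)`. -/
def semiGradient (β : Measure (S × A)) (θ : Vec N) (π : Policy S A) : Vec N :=
  ∫ x, (linearQ φ θ x - D.bellman π (linearQ φ θ) x) • φ x
    ∂(occupancy D.γ (D.stateActionKernel π) β)

/-- The approximate soft advantage function `A(s, a; θ, π)`. -/
def approxAdvantage (θ : Vec N) (π : Policy S A) (s : S) (a : A) : ℝ :=
  linearQ φ θ (s, a) + D.τ * llr (π.1 s) D.μ a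
    - ∫ a', (linearQ φ θ (s, a') + D.τ * llr (π.1 s) D.μ a') ∂(π.1 s)

/-- The mirror descent objective at the state `s`,
`∫ A(s, a; θ, π') π(da | s) + λ⁻¹ KL(π(· | s) | π'(· | s))`. -/
def mirrorObjective (lam : ℝ) (π π' : Policy S A) (θ : Vec N) (s : S) : ℝ :=
  ∫ a, D.approxAdvantage φ θ π' s a ∂(π.1 s) + 1 / lam * (klDiv (π.1 s) (π'.1 s)).toReal

/-- The objective `G̃(π, π', θ)`: the integral of the pointwise objectives over the state occupancy
measure `d_ρ^{π'}`. -/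
def integratedObjective (lam : ℝ) (ρ : Measure S) (π π' : Policy S A) (θ : Vec N) : ℝ :=
  ∫ s, D.mirrorObjective φ lam π π' θ s ∂(occupancy D.γ (D.stateKernel π') ρ)

/-- `πnew` is the mirror descent update of `π'` with critic parameter `θ`: it lies in `Π_μ` and
minimises `G̃(·, π', θ)` over `Π_μ`. As `G̃` does not see the states in a null set of `d_ρ^{π'}`, the
minimiser of `G̃` is determined only up to such sets; the update is the version which minimises at
every state. -/
structure IsMirrorStep (lam : ℝ) (ρ : Measure S) (π' : Policy S A) (θ : Vec N)
    (πnew : Policy S A) : Prop where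
  mem : πnew ∈ D.admissible
  integrated : ∀ π ∈ D.admissible,
    D.integratedObjective φ lam ρ πnew π' θ ≤ D.integratedObjective φ lam ρ π π' θ
  pointwise : ∀ π ∈ D.admissible, ∀ s,
    D.mirrorObjective φ lam πnew π' θ s ≤ D.mirrorObjective φ lam π π' θ s

/-- `(θ^n, π^n)` are iterates of the double loop actor-critic algorithm with critic step size `h`,
actor step size `lam` and `M n` temporal difference steps in the `n`-th round:
`θ^{n+1}` is obtained from `θ^n` by `M n` steps `θ ← θ - h g(θ, π^n)`, and
`π^{n+1}` is the mirror descent update of `π^n` with parameter `θ^{n+1}`. The initial `θ^0` is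
arbitrary and the initial policy `π^0` lies in `Π_μ`. -/
structure IsDoubleLoopRun (β : Measure (S × A)) (ρ : Measure S) (h lam : ℝ) (M : ℕ → ℕ)
    (θ : ℕ → Vec N) (π : ℕ → Policy S A) : Prop where
  init : π 0 ∈ D.admissible
  critic : ∀ n, θ (n + 1) = (fun ϑ => ϑ - h • D.semiGradient φ β ϑ (π n))^[M n] (θ n)
  actor : ∀ n, D.IsMirrorStep φ lam ρ (π n) (θ (n + 1)) (π (n + 1))

/-- Realisability: `Q^π_τ` is linear in the features for every `π ∈ Π_μ`. -/
def Realisable : Prop :=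
  ∀ π ∈ D.admissible, ∃ θ : Vec N, ∀ x, D.qValue π x = linearQ φ θ x

/-- `Γ = (1 - γ) (1 - √γ) λ_β` with `λ_β` the smallest eigenvalue of `∫ φ φᵀ dβ`. -/
def Gam (β : Measure (S × A)) : ℝ :=
  (1 - D.γ) * (1 - √D.γ) * minEigenvalue (featureCovariance φ β)

end MDP

end

end EntropyMDP

/-! The danger is a feedback loop: the actor may worsen the value by an amount proportional to the
critic error, and the critic error scales with the size of the parameter it tracks, hence with the
value. Summability of the critic's contraction factors breaks the loop. Let `ϑ n` represent the
exact Q-function of `π n`, and let `ε n = ‖θ (n+1) - ϑ n‖`. Three estimates carry the proof. Critic: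
the Bellman residual is linear in `θ - ϑ n`, and the semi-gradient is coercive with constant Γ
(`coercive_semiGradient`). Each TD step thus contracts the squared error by `1 - hΓ`, and the choice
of `M n` gives `ε n ≤ (κ(n+1))⁻² ‖θ n - ϑ n‖`. Actor: comparing the new policy with the old one in
the mirror objective, and using `τλ < 1`, gives approximate policy improvement, `V^{n+1} ≤ V^n + 2 ε
n / (1 - γ)` (`value_le_of_regularised_le`). Since KL is nonnegative, values are bounded below by
the cost alone. Link: bounded values bound the Q-functions, hence `ϑ n`, because the feature
covariance is nondegenerate (`norm_param_le`). Together they yield `x (n+1) ≤ (1 + d n) x n` with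
summable `d`, so `x` is bounded. The KL bound then follows from the Bellman equation, solved for τ
KL. -/

namespace EntropyMDP

noncomputable section

/-! ### Bounded measurable functions and integration against kernels -/

/-- Bounded measurable real functions. -/
def BddMeas {X : Type*} [MeasurableSpace X] (f : X → ℝ) : Prop :=
  Measurable f ∧ ∃ C : ℝ, ∀ x, |f x| ≤ C

namespace BddMeas

variable {X Y : Type*} [MeasurableSpace X] [MeasurableSpace Y] {f g : X → ℝ}

lemma integrable (hf : BddMeas f) (m : Measure X) [IsFiniteMeasure m] : Integrable f m := by
  obtain ⟨hm, C, hC⟩ := hf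
  exact Integrable.of_bound hm.aestronglyMeasurable C (Filter.Eventually.of_forall hC)

lemma const (c : ℝ) : BddMeas (fun _ : X => c) := ⟨measurable_const, |c|, fun _ => le_rfl⟩

lemma add (hf : BddMeas f) (hg : BddMeas g) : BddMeas (fun x => f x + g x) := by
  obtain ⟨hm, C, hC⟩ := hf
  obtain ⟨hm', C', hC'⟩ := hg
  exact ⟨hm.add hm', C + C', fun x => (abs_add_le _ _).trans (add_le_add (hC x) (hC' x))⟩

lemma const_mul (hf : BddMeas f) (c : ℝ) : BddMeas (fun x => c * f x) := by
  obtain ⟨hm, C, hC⟩ := hf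
  refine ⟨hm.const_mul c, |c| * C, fun x => ?_⟩
  rw [abs_mul]
  exact mul_le_mul_of_nonneg_left (hC x) (abs_nonneg c)

lemma sub (hf : BddMeas f) (hg : BddMeas g) : BddMeas (fun x => f x - g x) := by
  simpa [sub_eq_add_neg] using hf.add (hg.const_mul (-1))

lemma mul (hf : BddMeas f) (hg : BddMeas g) : BddMeas (fun x => f x * g x) := by
  obtain ⟨hm, C, hC⟩ := hf
  obtain ⟨hm', C', hC'⟩ := hg
  refine ⟨hm.mul hm', C * C', fun x => ?_⟩
  rw [abs_mul]
  exact mul_le_mul (hC x) (hC' x) (abs_nonneg _) ((abs_nonneg _).trans (hC x))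

lemma pow_two (hf : BddMeas f) : BddMeas (fun x => f x ^ 2) := by
  simpa [sq] using hf.mul hf

lemma comp {u : Y → X} (hf : BddMeas f) (hu : Measurable u) : BddMeas (fun y => f (u y)) :=
  ⟨hf.1.comp hu, hf.2.imp fun _ hC y => hC (u y)⟩

lemma abs_integral_le {C : ℝ} (hC : ∀ x, |f x| ≤ C) (m : Measure X) [IsProbabilityMeasure m] :
    |∫ x, f x ∂m| ≤ C := by
  simpa using norm_integral_le_of_norm_le_const (μ := m) (f := f) (C := C)
    (Filter.Eventually.of_forall hC)

lemma kernel_integral (hf : BddMeas f) (κ : Kernel Y X) [IsMarkovKernel κ] :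
    BddMeas (fun y => ∫ x, f x ∂κ y) := by
  obtain ⟨hm, C, hC⟩ := hf
  exact ⟨(hm.stronglyMeasurable.integral_kernel (κ := κ)).measurable, C,
    fun y => abs_integral_le hC _⟩

lemma kernel_integral_prod {f : Y × X → ℝ} (hf : BddMeas f) (κ : Kernel Y X) [IsMarkovKernel κ] :
    BddMeas (fun y => ∫ x, f (y, x) ∂κ y) := by
  obtain ⟨hm, C, hC⟩ := hf
  exact ⟨(hm.stronglyMeasurable.integral_kernel_prod_right' (κ := κ)).measurable, C,
    fun y => abs_integral_le (fun x => hC (y, x)) _⟩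

lemma integrable_exp (hf : BddMeas f) (m : Measure X) [IsFiniteMeasure m] :
    Integrable (fun x => Real.exp (f x)) m := by
  obtain ⟨hm, C, hC⟩ := hf
  refine Integrable.of_bound hm.exp.aestronglyMeasurable (Real.exp C)
    (Filter.Eventually.of_forall fun x => ?_)
  rw [Real.norm_eq_abs, Real.abs_exp]
  exact Real.exp_le_exp.2 ((le_abs_self _).trans (hC x))

end BddMeas

lemma integral_bind_kernel {X Y : Type*} [MeasurableSpace X] [MeasurableSpace Y] {f : Y → ℝ}
    (hf : BddMeas f) (κ : Kernel X Y) [IsMarkovKernel κ] (m : Measure X) [IsProbabilityMeasure m] :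
    ∫ y, f y ∂(m.bind κ) = ∫ x, ∫ y, f y ∂κ x ∂m := by
  have h := hf.integrable (m.bind κ)
  rw [Measure.comp_eq_comp_const_apply] at h ⊢
  rw [Kernel.integral_comp h, Kernel.const_apply]

/-! ### Relative entropy of exponentially tilted measures -/

section Tilted

variable {A : Type*} [MeasurableSpace A] (μ : Measure A) [IsProbabilityMeasure μ] {f g : A → ℝ}

lemma llr_tilted_self_ae (hf : BddMeas f) :
    llr (μ.tilted f) μ =ᵐ[μ] fun x => f x - Real.log (∫ x, Real.exp (f x) ∂μ) :=
  log_rnDeriv_tilted_left_self (hf.integrable_exp μ)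

lemma integrable_llr_tilted_self (hf : BddMeas f) (ν : Measure A) [IsProbabilityMeasure ν]
    (hν : ν ≪ μ) : Integrable (llr (μ.tilted f) μ) ν :=
  (integrable_congr (hν.ae_eq (llr_tilted_self_ae μ hf))).2
    ((hf.sub (BddMeas.const _)).integrable ν)

lemma toReal_klDiv_tilted_self (hf : BddMeas f) :
    (klDiv (μ.tilted f) μ).toReal = ∫ x, llr (μ.tilted f) μ x ∂(μ.tilted f) := by
  have := isProbabilityMeasure_tilted (hf.integrable_exp μ)
  exact toReal_klDiv_of_measure_eq (tilted_absolutelyContinuous μ f) (by simp)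

lemma toReal_klDiv_tilted_self_eq (hf : BddMeas f) :
    (klDiv (μ.tilted f) μ).toReal
      = ∫ x, f x ∂(μ.tilted f) - Real.log (∫ x, Real.exp (f x) ∂μ) := by
  have := isProbabilityMeasure_tilted (hf.integrable_exp μ)
  rw [toReal_klDiv_tilted_self μ hf, integral_congr_ae
    ((tilted_absolutelyContinuous μ f).ae_eq (llr_tilted_self_ae μ hf)),
    integral_sub (hf.integrable _) (integrable_const _)]
  simp

lemma klDiv_tilted_self_ne_top (hf : BddMeas f) : klDiv (μ.tilted f) μ ≠ ⊤ := by
  have := isProbabilityMeasure_tilted (hf.integrable_exp μ)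
  exact klDiv_ne_top (tilted_absolutelyContinuous μ f)
    (integrable_llr_tilted_self μ hf _ (tilted_absolutelyContinuous μ f))

/-- Chain rule for log-densities, split into two integrals because both are integrable. It lets the
mirror descent penalty `KL(p|q)` combine with the log-density of `q` into `KL(p|μ)`. -/
lemma toReal_klDiv_tilted_tilted (hf : BddMeas f) (hg : BddMeas g) :
    (klDiv (μ.tilted f) (μ.tilted g)).toReal
      = (klDiv (μ.tilted f) μ).toReal - ∫ x, llr (μ.tilted g) μ x ∂(μ.tilted f) := by
  have := isProbabilityMeasure_tilted (hf.integrable_exp μ)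
  have := isProbabilityMeasure_tilted (hg.integrable_exp μ)
  have hfac := tilted_absolutelyContinuous μ f
  have hac : μ.tilted f ≪ μ.tilted g :=
    hfac.trans (absolutelyContinuous_tilted (hg.integrable_exp μ))
  rw [toReal_klDiv_of_measure_eq hac (by simp), toReal_klDiv_tilted_self μ hf,
    ← integral_sub (integrable_llr_tilted_self μ hf _ hfac)
      (integrable_llr_tilted_self μ hg _ hfac)]
  refine integral_congr_ae ?_
  filter_upwards [llr_tilted_right hfac (hg.integrable_exp μ),
    hfac.ae_eq (llr_tilted_self_ae μ hg)] with x h1 h2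
  rw [h1, h2]
  ring

end Tilted

/-! ### Discounted potentials of a Markov kernel -/

/-- The operator `f ↦ (x ↦ ∫ f(y) κ(dy | x))` of a kernel. -/
def kernelOp {X : Type*} [MeasurableSpace X] (κ : Kernel X X) (f : X → ℝ) (x : X) : ℝ :=
  ∫ y, f y ∂κ x

/-- The discounted potential `∑ₙ γⁿ κⁿ r`. -/
def potential {X : Type*} [MeasurableSpace X] (γ : ℝ) (κ : Kernel X X) (r : X → ℝ) (x : X) : ℝ :=
  ∑' n : ℕ, γ ^ n * (kernelOp κ)^[n] r x

section Potential

variable {X : Type*} [MeasurableSpace X] {κ : Kernel X X} {r : X → ℝ} {γ : ℝ}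

lemma measurable_iterate_kernelOp (hr : Measurable r) (n : ℕ) :
    Measurable ((kernelOp κ)^[n] r) := by
  induction n with
  | zero => exact hr
  | succ n ih =>
    rw [Function.iterate_succ_apply']
    exact (ih.stronglyMeasurable.integral_kernel (κ := κ)).measurable

variable [IsMarkovKernel κ]

lemma abs_iterate_kernelOp_le {C : ℝ} (hC : ∀ x, |r x| ≤ C) (n : ℕ) (x : X) :
    |(kernelOp κ)^[n] r x| ≤ C := by
  induction n generalizing x with
  | zero => exact hC x
  | succ n ih =>
    rw [Function.iterate_succ_apply']
    exact BddMeas.abs_integral_le ih _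

lemma bddMeas_iterate_kernelOp (hr : BddMeas r) (n : ℕ) : BddMeas ((kernelOp κ)^[n] r) :=
  ⟨measurable_iterate_kernelOp hr.1 n, hr.2.imp fun _ hC => abs_iterate_kernelOp_le hC n⟩

lemma integral_iterate_bind (hr : BddMeas r) (m : Measure X) [IsProbabilityMeasure m] (n : ℕ) :
    ∫ x, r x ∂((fun m : Measure X => m.bind κ)^[n] m) = ∫ x, (kernelOp κ)^[n] r x ∂m := by
  induction n generalizing m with
  | zero => rfl
  | succ n ih =>
    have : IsProbabilityMeasure (m.bind κ) := inferInstance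
    -- The measure iterate is unfolded at its first step and the operator iterate at its last, so
    -- the induction hypothesis is needed for a varying initial law.
    rw [Function.iterate_succ_apply, ih (m.bind κ), Function.iterate_succ_apply',
      integral_bind_kernel (bddMeas_iterate_kernelOp hr n)]
    rfl

lemma hasSum_integral_discounted {Ω : Type*} [MeasurableSpace Ω] (m : Measure Ω)
    [IsProbabilityMeasure m] {u : ℕ → Ω → ℝ} (hu : ∀ n, Measurable (u n)) {C : ℝ}
    (hC : ∀ n x, |u n x| ≤ C) (h0 : 0 ≤ γ) (h1 : γ < 1) :
    HasSum (fun n => γ ^ n * ∫ x, u n x ∂m) (∫ x, ∑' n, γ ^ n * u n x ∂m) := by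
  have hint : ∀ n, Integrable (fun x => γ ^ n * u n x) m := fun n =>
    (BddMeas.integrable ⟨hu n, C, hC n⟩ m).const_mul _
  have := hasSum_integral_of_summable_integral_norm (μ := m) hint ?_
  · simpa only [integral_const_mul] using this
  · refine Summable.of_nonneg_of_le (fun n => integral_nonneg fun x => norm_nonneg _)
      (fun n => ?_) ((summable_geometric_of_lt_one h0 h1).mul_right C)
    have hb : ∀ x, ‖γ ^ n * u n x‖ ≤ γ ^ n * C := fun x => by
      rw [norm_mul, Real.norm_of_nonneg (pow_nonneg h0 n)]
      exact mul_le_mul_of_nonneg_left (hC n x) (pow_nonneg h0 n)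
    calc ∫ x, ‖γ ^ n * u n x‖ ∂m ≤ ∫ _, γ ^ n * C ∂m :=
          integral_mono (hint n).norm (integrable_const _) hb
      _ = γ ^ n * C := by simp

lemma summable_discounted {u : ℕ → ℝ} {C : ℝ} (hC : ∀ n, |u n| ≤ C) (h0 : 0 ≤ γ) (h1 : γ < 1) :
    Summable fun n => γ ^ n * u n := by
  refine Summable.of_norm_bounded ((summable_geometric_of_lt_one h0 h1).mul_right C) fun n => ?_
  rw [norm_mul, Real.norm_of_nonneg (pow_nonneg h0 n)]
  exact mul_le_mul_of_nonneg_left (hC n) (pow_nonneg h0 n)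

lemma abs_tsum_discounted_le {u : ℕ → ℝ} {C : ℝ} (hC : ∀ n, |u n| ≤ C) (h0 : 0 ≤ γ)
    (h1 : γ < 1) : |∑' n, γ ^ n * u n| ≤ (1 - γ)⁻¹ * C := by
  refine tsum_of_norm_bounded (f := fun n => γ ^ n * u n) (g := fun n => γ ^ n * C)
    ((hasSum_geometric_of_lt_one h0 h1).mul_right C) fun n => ?_
  rw [norm_mul, Real.norm_of_nonneg (pow_nonneg h0 n)]
  exact mul_le_mul_of_nonneg_left (hC n) (pow_nonneg h0 n)

lemma bddMeas_potential (hr : BddMeas r) (h0 : 0 ≤ γ) (h1 : γ < 1) :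
    BddMeas (potential γ κ r) := by
  obtain ⟨hm, C, hC⟩ := hr
  exact ⟨Measurable.tsum fun n => (measurable_iterate_kernelOp hm n).const_mul _,
    (1 - γ)⁻¹ * C, fun x => abs_tsum_discounted_le (fun n => abs_iterate_kernelOp_le hC n x) h0 h1⟩

/-- Split off the term `n = 0`; in the tail one factor γκ comes out, the geometric bound allowing
sum and integral to be exchanged. -/
lemma potential_eq (hr : BddMeas r) (h0 : 0 ≤ γ) (h1 : γ < 1) (x : X) :
    potential γ κ r x = r x + γ * ∫ y, potential γ κ r y ∂κ x := by
  obtain ⟨hm, C, hC⟩ := hr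
  have hs := hasSum_integral_discounted (κ x) (measurable_iterate_kernelOp (κ := κ) hm)
    (abs_iterate_kernelOp_le hC) h0 h1
  unfold potential
  rw [(summable_discounted (fun n => abs_iterate_kernelOp_le hC n x) h0 h1).tsum_eq_zero_add,
    ← hs.tsum_eq, ← tsum_mul_left]
  simp only [pow_zero, one_mul, Function.iterate_zero, id, pow_succ, Function.iterate_succ_apply',
    kernelOp]
  congr 1
  refine tsum_congr fun n => ?_
  ring

end Potential

/-! ### One-dimensional marginals of the trajectory measure -/

section Trajectory

variable {X : Type*} [MeasurableSpace X] (ν : Measure X)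

lemma map_zero_trajMeasure
    (κ : (n : ℕ) → Kernel ((i : Finset.Iic n) → (fun _ : ℕ => X) i) X) [∀ n, IsMarkovKernel (κ n)] :
    (Kernel.trajMeasure (X := fun _ => X) ν κ).map (fun ω => ω 0) = ν := by
  have hf : (fun ω : ℕ → X => ω 0)
      = (fun x : (i : Finset.Iic 0) → X => x ⟨0, Finset.mem_Iic.2 le_rfl⟩)
        ∘ Preorder.frestrictLe (π := fun _ => X) 0 := rfl
  have h1 : (Kernel.trajMeasure (X := fun _ => X) ν κ).map
      (Preorder.frestrictLe (π := fun _ => X) 0) = ν.map (MeasurableEquiv.piUnique _).symm := by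
    rw [Kernel.trajMeasure, Measure.map_comp _ _ (by fun_prop),
      Kernel.traj_map_frestrictLe_of_le le_rfl, Measure.deterministic_comp_eq_map]
    exact Measure.map_id
  rw [hf, ← Measure.map_map (by fun_prop) (by fun_prop), h1,
    Measure.map_map (by fun_prop) (by fun_prop)]
  exact Measure.map_id

variable [IsProbabilityMeasure ν] in
-- Take the second marginal of the joint law of the history up to `n` and the next state; the step
-- kernel sees only the last coordinate of the history.
lemma map_succ_trajMeasure (κ : Kernel X X) [IsMarkovKernel κ] (n : ℕ) :
    (Kernel.trajMeasure (X := fun _ => X) ν fun n => κ.comap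
      (fun x : (i : Finset.Iic n) → X => x ⟨n, Finset.mem_Iic.2 le_rfl⟩)
      (measurable_pi_apply _)).map (fun ω => ω (n + 1))
    = ((Kernel.trajMeasure (X := fun _ => X) ν fun n => κ.comap
      (fun x : (i : Finset.Iic n) → X => x ⟨n, Finset.mem_Iic.2 le_rfl⟩)
      (measurable_pi_apply _)).map (fun ω => ω n)).bind κ := by
  set η : (n : ℕ) → Kernel ((i : Finset.Iic n) → X) X := fun n => κ.comap
      (fun x : (i : Finset.Iic n) → X => x ⟨n, Finset.mem_Iic.2 le_rfl⟩)
      (measurable_pi_apply _)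
  have h := congrArg Measure.snd (Kernel.map_frestrictLe_trajMeasure_compProd_eq_map_trajMeasure
    (X := fun _ => X) (μ₀ := ν) (κ := η) (a := n))
  rw [Measure.snd_compProd, Measure.snd, Measure.map_map (by fun_prop) (by fun_prop)] at h
  change _ = (Kernel.trajMeasure (X := fun _ => X) ν η).map (fun ω => ω (n + 1)) at h
  rw [← h]
  ext t ht
  rw [Measure.bind_apply ht (by fun_prop), Measure.bind_apply ht (by fun_prop),
    lintegral_map ((η n).measurable_coe ht) (by fun_prop),
    lintegral_map (κ.measurable_coe ht) (by fun_prop)]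
  rfl

end Trajectory

/-! ### Value functions and the on-policy Bellman equations -/

namespace MDP

variable {S A : Type*} [MeasurableSpace S] [MeasurableSpace A] (D : MDP S A) {π : Policy S A}

lemma bddMeas_cost : BddMeas D.cost := ⟨D.measurable_cost, D.bounded_cost⟩

lemma bddMeas_kl (hπ : π ∈ D.admissible) : BddMeas (D.kl π) := by
  obtain ⟨f, hm, ⟨C, hC⟩, hf⟩ := hπ
  have hfs : ∀ s, BddMeas fun a => f (s, a) := fun s => BddMeas.comp ⟨hm, C, hC⟩ (by fun_prop)
  have h1 : D.kl π = fun s => ∫ a, f (s, a) ∂π.1 s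
      - Real.log (∫ a, Real.exp (f (s, a)) ∂(Kernel.const S D.μ s)) := by
    ext s
    rw [kl, hf s, toReal_klDiv_tilted_self_eq D.μ (hfs s)]
    rfl
  have hexp : BddMeas fun x => Real.exp (f x) := ⟨hm.exp, Real.exp C, fun x => by
    rw [Real.abs_exp]; exact Real.exp_le_exp.2 ((le_abs_self _).trans (hC x))⟩
  rw [h1]
  refine (BddMeas.kernel_integral_prod ⟨hm, C, hC⟩ π.1).sub
    ⟨(hexp.kernel_integral_prod (Kernel.const S D.μ)).1.log, C, fun s => ?_⟩
  have hint := (hfs s).integrable_exp D.μ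
  -- The normaliser lies between `exp (-C)` and `exp C` uniformly in `s`, so its logarithm is
  -- bounded by `C`.
  have hlow : Real.exp (-C) ≤ ∫ a, Real.exp (f (s, a)) ∂D.μ := by
    simpa using integral_mono (μ := D.μ) (integrable_const (Real.exp (-C))) hint
      fun a => Real.exp_le_exp.2 (abs_le.1 (hC (s, a))).1
  have hup : ∫ a, Real.exp (f (s, a)) ∂D.μ ≤ Real.exp C := by
    simpa using integral_mono (μ := D.μ) hint (integrable_const (Real.exp C))
      fun a => Real.exp_le_exp.2 (abs_le.1 (hC (s, a))).2
  simp only [Kernel.const_apply, abs_le]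
  have hpos := (Real.exp_pos _).trans_le hlow
  exact ⟨(Real.le_log_iff_exp_le hpos).2 hlow, (Real.log_le_iff_le_exp hpos).2 hup⟩

/-- The running cost `c(s, a) + τ KL(π(· | s) | μ)`. -/
def regCost (π : Policy S A) (x : S × A) : ℝ := D.cost x + D.τ * D.kl π x.1

lemma bddMeas_regCost (hπ : π ∈ D.admissible) : BddMeas (D.regCost π) :=
  D.bddMeas_cost.add (((D.bddMeas_kl hπ).comp measurable_fst).const_mul D.τ)

instance (π : Policy S A) (s : S) : IsProbabilityMeasure (D.trajectory π s) := by
  unfold trajectory; infer_instance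

lemma map_zero_trajectory (π : Policy S A) (s : S) :
    (D.trajectory π s).map (fun ω => ω 0) = (Measure.dirac s).compProd π.1 :=
  map_zero_trajMeasure _ _

lemma map_succ_trajectory (π : Policy S A) (s : S) (n : ℕ) :
    (D.trajectory π s).map (fun ω => ω (n + 1))
      = ((D.trajectory π s).map fun ω => ω n).bind (D.stateActionKernel π) :=
  map_succ_trajMeasure _ _ n

lemma map_trajectory (π : Policy S A) (s : S) (n : ℕ) :
    (D.trajectory π s).map (fun ω => ω n)
      = (fun m : Measure (S × A) => m.bind (D.stateActionKernel π))^[n]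
        ((Measure.dirac s).compProd π.1) := by
  induction n with
  | zero => exact D.map_zero_trajectory π s
  | succ n ih => rw [map_succ_trajectory, ih, Function.iterate_succ_apply']

lemma integral_dirac_compProd {f : S × A → ℝ} (hf : BddMeas f) (π : Policy S A) (s : S) :
    ∫ x, f x ∂((Measure.dirac s).compProd π.1) = ∫ a, f (s, a) ∂π.1 s := by
  rw [Measure.integral_compProd (hf.integrable _),
    integral_dirac' _ _ (hf.kernel_integral_prod π.1).1.stronglyMeasurable]

/-- Both sides are sums of the same discounted terms, as the law of the `n`-th state-action pair is
the initial law pushed through the kernel `n` times. The trajectory measure is not needed after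
this. -/
lemma value_eq_integral_potential (hπ : π ∈ D.admissible) (s : S) :
    D.value π s = ∫ a, potential D.γ (D.stateActionKernel π) (D.regCost π) (s, a) ∂π.1 s := by
  have hr := D.bddMeas_regCost hπ
  have hpot := bddMeas_potential (κ := D.stateActionKernel π) hr D.γ_pos.le D.γ_lt_one
  obtain ⟨C, hC⟩ := hr.2
  rw [← integral_dirac_compProd hpot π s]
  have h1 := hasSum_integral_discounted (D.trajectory π s)
    (u := fun n ω => D.regCost π (ω n)) (fun n => hr.1.comp (measurable_pi_apply n))
    (fun n ω => hC (ω n)) D.γ_pos.le D.γ_lt_one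
  have h2 := hasSum_integral_discounted ((Measure.dirac s).compProd π.1)
    (measurable_iterate_kernelOp (κ := D.stateActionKernel π) hr.1) (abs_iterate_kernelOp_le hC)
    D.γ_pos.le D.γ_lt_one
  refine (h1.unique ?_)
  convert! h2 using 3 with n
  rw [← integral_iterate_bind hr, ← map_trajectory,
    integral_map (measurable_pi_apply n).aemeasurable hr.1.aestronglyMeasurable]

lemma bddMeas_value (hπ : π ∈ D.admissible) : BddMeas (D.value π) := by
  have h := (bddMeas_potential (κ := D.stateActionKernel π) (D.bddMeas_regCost hπ) D.γ_pos.le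
    D.γ_lt_one).kernel_integral_prod π.1
  simpa only [← D.value_eq_integral_potential hπ] using h

lemma bddMeas_qValue (hπ : π ∈ D.admissible) : BddMeas (D.qValue π) :=
  D.bddMeas_cost.add (((D.bddMeas_value hπ).kernel_integral D.P).const_mul D.γ)

lemma integral_stateActionKernel {f : S × A → ℝ} (hf : BddMeas f) (π : Policy S A) (x : S × A) :
    ∫ y, f y ∂(D.stateActionKernel π x) = ∫ s', ∫ a', f (s', a') ∂π.1 s' ∂D.P x := by
  have h := hf.integrable (D.stateActionKernel π x)
  unfold stateActionKernel at h ⊢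
  rw [integral_compProd h]
  rfl

/-- The on-policy Bellman equation. -/
lemma value_eq (hπ : π ∈ D.admissible) (s : S) :
    D.value π s = ∫ a, D.qValue π (s, a) ∂π.1 s + D.τ * D.kl π s := by
  have hr := D.bddMeas_regCost hπ
  have hpot := bddMeas_potential (κ := D.stateActionKernel π) hr D.γ_pos.le D.γ_lt_one
  have key : ∀ a, potential D.γ (D.stateActionKernel π) (D.regCost π) (s, a)
      = D.qValue π (s, a) + D.τ * D.kl π s := fun a => by
    rw [potential_eq hr D.γ_pos.le D.γ_lt_one, D.integral_stateActionKernel hpot]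
    simp only [← D.value_eq_integral_potential hπ, qValue, regCost]
    ring
  rw [D.value_eq_integral_potential hπ]
  simp only [key]
  rw [integral_add (((D.bddMeas_qValue hπ).comp (by fun_prop)).integrable _) (integrable_const _)]
  simp

lemma bellman_qValue (hπ : π ∈ D.admissible) (x : S × A) :
    D.bellman π (D.qValue π) x = D.qValue π x := by
  have hq := D.bddMeas_qValue hπ
  rw [bellman, D.integral_stateActionKernel hq]
  conv_rhs => rw [qValue]
  simp only [D.value_eq hπ]
  rw [integral_add ((hq.kernel_integral_prod π.1).integrable _)
    (((D.bddMeas_kl hπ).const_mul _).integrable _), integral_const_mul]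
  ring

end MDP

/-! ### Occupancy measures and coercivity -/

section Occupancy

variable {X : Type*} [MeasurableSpace X] {κ : Kernel X X} {β : Measure X} {γ : ℝ}

lemma smul_le_occupancy : ENNReal.ofReal (1 - γ) • β ≤ occupancy γ κ β := by
  rw [occupancy]
  simpa using Measure.le_sum (fun n : ℕ => ENNReal.ofReal ((1 - γ) * γ ^ n) •
    (fun m : Measure X => m.bind κ)^[n] β) 0

/-- Pushing forward and discounting shifts the defining series by one index, so the left side is the
series without its first term. -/
lemma smul_occupancy_bind_le (h0 : 0 ≤ γ) :
    ENNReal.ofReal γ • (occupancy γ κ β).bind κ ≤ occupancy γ κ β := by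
  rw [occupancy, Measure.bind_sum _ _ κ.measurable.aemeasurable]
  refine Measure.le_iff.2 fun s hs => ?_
  rw [Measure.smul_apply, Measure.sum_apply _ hs, Measure.sum_apply _ hs, smul_eq_mul,
    ← ENNReal.tsum_mul_left]
  refine le_trans (le_of_eq (tsum_congr fun n => ?_))
    (ENNReal.tsum_comp_le_tsum_of_injective Nat.succ_injective _)
  simp only [Measure.bind_smul, Measure.smul_apply, smul_eq_mul, Function.iterate_succ_apply',
    Nat.succ_eq_add_one]
  rw [← mul_assoc, ← ENNReal.ofReal_mul h0]
  congr 2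
  ring

lemma sq_integral_le {f : X → ℝ} (hf : BddMeas f) (m : Measure X) [IsProbabilityMeasure m] :
    (∫ x, f x ∂m) ^ 2 ≤ ∫ x, f x ^ 2 ∂m := by
  set c := ∫ x, f x ∂m with hc
  have h1 : 0 ≤ ∫ x, (f x - c) ^ 2 ∂m := integral_nonneg fun x => sq_nonneg _
  have h2 : ∫ x, (f x - c) ^ 2 ∂m = ∫ x, f x ^ 2 ∂m - c ^ 2 := by
    have e : ∀ x, (f x - c) ^ 2 = f x ^ 2 + (c ^ 2 - 2 * c * f x) := fun x => by ring
    simp only [e]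
    rw [integral_add (hf.pow_two.integrable _)
      (((BddMeas.const _).sub (hf.const_mul _)).integrable _),
      integral_sub (integrable_const _) ((hf.const_mul _).integrable _), integral_const_mul, ← hc]
    simp
    ring
  linarith

variable [IsMarkovKernel κ] [IsProbabilityMeasure β]

lemma isProbabilityMeasure_iterate_bind (n : ℕ) :
    IsProbabilityMeasure ((fun m : Measure X => m.bind κ)^[n] β) := by
  induction n with
  | zero => assumption
  | succ n ih => rw [Function.iterate_succ_apply']; infer_instance

lemma isProbabilityMeasure_occupancy (h0 : 0 ≤ γ) (h1 : γ < 1) :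
    IsProbabilityMeasure (occupancy γ κ β) := by
  refine ⟨?_⟩
  have hm : ∀ n, ((fun m : Measure X => m.bind κ)^[n] β) Set.univ = 1 := fun n =>
    (isProbabilityMeasure_iterate_bind n).measure_univ
  have hs := (hasSum_geometric_of_lt_one h0 h1).mul_left (1 - γ)
  rw [occupancy, Measure.sum_apply _ MeasurableSet.univ]
  simp only [Measure.smul_apply, hm, smul_eq_mul, mul_one]
  rw [← ENNReal.ofReal_tsum_of_nonneg
    (fun n => mul_nonneg (sub_nonneg.2 h1.le) (pow_nonneg h0 n)) hs.summable, hs.tsum_eq,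
    mul_inv_cancel₀ (sub_pos.2 h1).ne', ENNReal.ofReal_one]

lemma integral_le_integral_occupancy {f : X → ℝ} (hf : BddMeas f) (hf0 : ∀ x, 0 ≤ f x)
    (h0 : 0 ≤ γ) (h1 : γ < 1) :
    (1 - γ) * ∫ x, f x ∂β ≤ ∫ x, f x ∂(occupancy γ κ β) := by
  have := isProbabilityMeasure_occupancy (κ := κ) (β := β) h0 h1
  have h := integral_mono_measure (smul_le_occupancy (κ := κ) (β := β) (γ := γ))
    (Filter.Eventually.of_forall hf0) (hf.integrable _)
  rwa [integral_smul_measure, ENNReal.toReal_ofReal (sub_nonneg.2 h1.le), smul_eq_mul] at h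

lemma integral_kernel_occupancy_le {f : X → ℝ} (hf : BddMeas f) (hf0 : ∀ x, 0 ≤ f x)
    (h0 : 0 ≤ γ) (h1 : γ < 1) :
    γ * ∫ x, ∫ y, f y ∂κ x ∂(occupancy γ κ β) ≤ ∫ x, f x ∂(occupancy γ κ β) := by
  have := isProbabilityMeasure_occupancy (κ := κ) (β := β) h0 h1
  have h := integral_mono_measure (smul_occupancy_bind_le (κ := κ) (β := β) h0)
    (Filter.Eventually.of_forall hf0) (hf.integrable _)
  rwa [integral_smul_measure, ENNReal.toReal_ofReal h0, smul_eq_mul, integral_bind_kernel hf] at h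

/-- Coercivity of `u ↦ u - γ κ u` in `L²` of the occupancy measure. -/
lemma coercive_occupancy {u : X → ℝ} (hu : BddMeas u) (h0 : 0 < γ) (h1 : γ < 1) :
    (1 - √γ) * ∫ x, u x ^ 2 ∂(occupancy γ κ β)
      ≤ ∫ x, (u x - γ * ∫ y, u y ∂κ x) * u x ∂(occupancy γ κ β) := by
  have := isProbabilityMeasure_occupancy (κ := κ) (β := β) h0.le h1
  set d := occupancy γ κ β
  have hk := hu.kernel_integral κ
  have hk2 := hu.pow_two.kernel_integral κ
  have hE : γ * ∫ x, ∫ y, u y ^ 2 ∂κ x ∂d ≤ ∫ x, u x ^ 2 ∂d :=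
    integral_kernel_occupancy_le hu.pow_two (fun x => sq_nonneg _) h0.le h1
  have hsq : √γ * √γ = γ := Real.mul_self_sqrt h0.le
  have hs0 : 0 < √γ := Real.sqrt_pos.2 h0
  -- Young's inequality `γ w u ≤ (√γ/2)(u² + γ w²)`, then Jensen for `w²`. After integration, `hE`
  -- turns the second term into another `√γ/2`, which gives `1 - √γ`.
  have hpt : ∀ x, (1 - √γ / 2) * u x ^ 2 - √γ * γ / 2 * ∫ y, u y ^ 2 ∂κ x
      ≤ (u x - γ * ∫ y, u y ∂κ x) * u x := fun x => by
    have hj := sq_integral_le hu (κ x)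
    set w := ∫ y, u y ∂κ x
    have h3 : √γ * γ / 2 * w ^ 2 ≤ √γ * γ / 2 * ∫ y, u y ^ 2 ∂κ x :=
      mul_le_mul_of_nonneg_left hj (by positivity)
    have h4 : 0 ≤ √γ / 2 * (u x - √γ * w) ^ 2 := by positivity
    have h5 : √γ / 2 * (u x - √γ * w) ^ 2
        = √γ / 2 * u x ^ 2 - γ * w * u x + √γ * γ / 2 * w ^ 2 := by
      linear_combination (- w * u x + √γ / 2 * w ^ 2) * hsq
    linarith
  have hint := integral_mono (μ := d)
    (((hu.pow_two.const_mul (1 - √γ / 2)).sub (hk2.const_mul (√γ * γ / 2))).integrable d)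
    (((hu.sub (hk.const_mul γ)).mul hu).integrable d) hpt
  rw [integral_sub ((hu.pow_two.const_mul _).integrable d) ((hk2.const_mul _).integrable d),
    integral_const_mul, integral_const_mul] at hint
  nlinarith [mul_le_mul_of_nonneg_left hE (half_pos hs0).le]

end Occupancy

/-! ### Smallest eigenvalue as a Rayleigh bound -/

section MinEigenvalue

open Matrix

/-- Subtracting the smallest eigenvalue times the identity shifts the spectrum into the nonnegative
reals, so the difference is positive semidefinite. -/
lemma minEigenvalue_mul_le {N : ℕ} {B : Matrix (Fin N) (Fin N) ℝ} (hB : B.IsHermitian)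
    (v : Fin N → ℝ) : minEigenvalue B * (v ⬝ᵥ v) ≤ v ⬝ᵥ (B *ᵥ v) := by
  have hsub : (B - minEigenvalue B • (1 : Matrix (Fin N) (Fin N) ℝ)).IsHermitian :=
    hB.sub (by simp [IsHermitian])
  have hps : (B - minEigenvalue B • (1 : Matrix (Fin N) (Fin N) ℝ)).PosSemidef := by
    rw [hsub.posSemidef_iff_eigenvalues_nonneg]
    intro i
    have hmem : hsub.eigenvalues i ∈ spectrum ℝ (B - minEigenvalue B • 1) := by
      rw [hsub.spectrum_real_eq_range_eigenvalues]
      exact ⟨i, rfl⟩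
    have h2 : minEigenvalue B + hsub.eigenvalues i ∈ spectrum ℝ B := by
      rw [spectrum.mem_iff] at hmem ⊢
      convert! hmem using 2
      rw [Algebra.algebraMap_eq_smul_one, Algebra.algebraMap_eq_smul_one, add_smul]
      abel
    have hbdd : BddBelow (spectrum ℝ B) := by
      rw [hB.spectrum_real_eq_range_eigenvalues]
      exact (Set.finite_range _).bddBelow
    have := csInf_le hbdd h2
    change minEigenvalue B ≤ _ at this
    simpa using this
  have h := hps.dotProduct_mulVec_nonneg v
  simp only [star_trivial, sub_mulVec, smul_mulVec, one_mulVec, dotProduct_sub, dotProduct_smul,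
    smul_eq_mul] at h
  linarith

end MinEigenvalue

/-! ### Linear features and their covariance -/

section Features

variable {S A : Type*} {N : ℕ} {φ : S × A → Vec N}

lemma abs_linearQ_le (hφ : ∀ x, ‖φ x‖ ≤ 1) (v : Vec N) (x : S × A) : |linearQ φ v x| ≤ ‖v‖ :=
  (abs_real_inner_le_norm _ _).trans (mul_le_of_le_one_right (norm_nonneg _) (hφ x))

lemma linearQ_sub (v w : Vec N) (x : S × A) :
    linearQ φ (v - w) x = linearQ φ v x - linearQ φ w x := inner_sub_left _ _ _

variable [MeasurableSpace S] [MeasurableSpace A]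

lemma bddMeas_linearQ (hm : Measurable φ) (hφ : ∀ x, ‖φ x‖ ≤ 1) (v : Vec N) :
    BddMeas (linearQ φ v) :=
  ⟨Measurable.inner measurable_const hm, ‖v‖, abs_linearQ_le hφ v⟩

lemma minEigenvalue_mul_norm_sq_le (hm : Measurable φ) (hφ : ∀ x, ‖φ x‖ ≤ 1)
    (β : Measure (S × A)) [IsProbabilityMeasure β] (v : Vec N) :
    minEigenvalue (featureCovariance φ β) * ‖v‖ ^ 2 ≤ ∫ x, linearQ φ v x ^ 2 ∂β := by
  have hcoord : ∀ i, BddMeas fun x => φ x i := fun i =>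
    ⟨by fun_prop, 1, fun x => (PiLp.norm_apply_le (φ x) i).trans (hφ x)⟩
  have hH : (featureCovariance φ β).IsHermitian := by
    ext i j
    simp [featureCovariance, mul_comm]
  have h := minEigenvalue_mul_le hH v.ofLp
  have e1 : v.ofLp ⬝ᵥ v.ofLp = ‖v‖ ^ 2 := by
    rw [EuclideanSpace.real_norm_sq_eq]
    simp [dotProduct, sq]
  have e2 : v.ofLp ⬝ᵥ (Matrix.mulVec (featureCovariance φ β) v.ofLp)
      = ∫ x, linearQ φ v x ^ 2 ∂β := by
    have hpt : ∀ x, linearQ φ v x ^ 2 = ∑ i, ∑ j, (v i * v j) * (φ x i * φ x j) := fun x => by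
      rw [linearQ, PiLp.inner_apply, sq, Finset.sum_mul_sum]
      refine Finset.sum_congr rfl fun i _ => Finset.sum_congr rfl fun j _ => ?_
      simp
      ring
    simp only [hpt]
    have hi : ∀ i j, Integrable (fun x => (v i * v j) * (φ x i * φ x j)) β := fun i j =>
      (((hcoord i).mul (hcoord j)).const_mul _).integrable β
    rw [integral_finsetSum _ fun i _ => integrable_finsetSum _ fun j _ => hi i j]
    simp only [dotProduct, Matrix.mulVec, Finset.mul_sum]
    refine Finset.sum_congr rfl fun i _ => ?_
    rw [integral_finsetSum _ fun j _ => hi i j]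
    refine Finset.sum_congr rfl fun j _ => ?_
    rw [integral_const_mul, featureCovariance, Matrix.of_apply]
    ring
  rwa [e1, e2] at h

end Features

/-! ### Convergence of the temporal difference critic -/

namespace MDP

variable {S A : Type*} [MeasurableSpace S] [MeasurableSpace A] (D : MDP S A) {π : Policy S A}
  {N : ℕ} {φ : S × A → Vec N} {β : Measure (S × A)} [IsProbabilityMeasure β]

/-- The temporal difference of `f` without the cost: `f - γ P^π f`. -/
def homogeneousTD (π : Policy S A) (f : S × A → ℝ) (x : S × A) : ℝ :=
  f x - D.γ * ∫ y, f y ∂(D.stateActionKernel π x)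

lemma bddMeas_homogeneousTD {f : S × A → ℝ} (hf : BddMeas f) (π : Policy S A) :
    BddMeas (D.homogeneousTD π f) :=
  hf.sub ((hf.kernel_integral _).const_mul _)

/-- The exact Q-function is a Bellman fixed point, so subtracting its equation cancels the cost and
KL terms. -/
lemma linearQ_sub_bellman (hm : Measurable φ) (hφ : ∀ x, ‖φ x‖ ≤ 1) (hπ : π ∈ D.admissible)
    {ϑ : Vec N} (hϑ : ∀ x, D.qValue π x = linearQ φ ϑ x) (v : Vec N) (x : S × A) :
    linearQ φ v x - D.bellman π (linearQ φ v) x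
      = D.homogeneousTD π (linearQ φ (v - ϑ)) x := by
  have h := D.bellman_qValue hπ x
  rw [funext hϑ] at h
  have hi := fun w => (bddMeas_linearQ hm hφ w).integrable (D.stateActionKernel π x)
  unfold bellman at h ⊢
  rw [homogeneousTD, funext (linearQ_sub (φ := φ) v ϑ), integral_sub (hi _) (hi _)]
  linarith

lemma norm_semiGradient_le (hm : Measurable φ) (hφ : ∀ x, ‖φ x‖ ≤ 1) (hπ : π ∈ D.admissible)
    {ϑ : Vec N} (hϑ : ∀ x, D.qValue π x = linearQ φ ϑ x) (v : Vec N) :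
    ‖D.semiGradient φ β v π‖ ≤ (1 + D.γ) * ‖v - ϑ‖ := by
  have := isProbabilityMeasure_occupancy (κ := D.stateActionKernel π) (β := β) D.γ_pos.le D.γ_lt_one
  have hb := abs_linearQ_le hφ (v - ϑ)
  rw [semiGradient]
  simp only [D.linearQ_sub_bellman hm hφ hπ hϑ]
  have hpt : ∀ x, ‖D.homogeneousTD π (linearQ φ (v - ϑ)) x • φ x‖ ≤ (1 + D.γ) * ‖v - ϑ‖ := by
    intro x
    rw [norm_smul, Real.norm_eq_abs]
    refine (mul_le_of_le_one_right (abs_nonneg _) (hφ x)).trans ?_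
    refine (abs_sub _ _).trans ?_
    rw [abs_mul, abs_of_pos D.γ_pos, add_mul, one_mul]
    exact add_le_add (hb x)
      (mul_le_mul_of_nonneg_left (BddMeas.abs_integral_le hb _) D.γ_pos.le)
  simpa using norm_integral_le_of_norm_le_const (μ := occupancy D.γ (D.stateActionKernel π) β)
    (Filter.Eventually.of_forall hpt)

/-- The inner product is the quadratic form of `coercive_occupancy` at `u = ⟨v - ϑ, φ⟩`. The three
factors of Γ come from that lemma, from `d ≥ (1 - γ) β`, and from the covariance. -/
lemma coercive_semiGradient (hm : Measurable φ) (hφ : ∀ x, ‖φ x‖ ≤ 1) (hπ : π ∈ D.admissible)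
    {ϑ : Vec N} (hϑ : ∀ x, D.qValue π x = linearQ φ ϑ x) (v : Vec N) :
    D.Gam φ β * ‖v - ϑ‖ ^ 2 ≤ inner ℝ (v - ϑ) (D.semiGradient φ β v π) := by
  have := isProbabilityMeasure_occupancy (κ := D.stateActionKernel π) (β := β) D.γ_pos.le D.γ_lt_one
  have hu := bddMeas_linearQ hm hφ (v - ϑ)
  have htd := D.bddMeas_homogeneousTD hu π
  have hint : Integrable (fun x => D.homogeneousTD π (linearQ φ (v - ϑ)) x • φ x)
      (occupancy D.γ (D.stateActionKernel π) β) := by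
    obtain ⟨C, hC⟩ := htd.2
    refine Integrable.of_bound (htd.1.smul hm).aestronglyMeasurable C
      (Filter.Eventually.of_forall fun x => ?_)
    rw [norm_smul]
    exact (mul_le_of_le_one_right (norm_nonneg _) (hφ x)).trans (hC x)
  rw [semiGradient]
  simp only [D.linearQ_sub_bellman hm hφ hπ hϑ]
  rw [← integral_inner hint]
  simp only [inner_smul_right]
  have hc := coercive_occupancy (κ := D.stateActionKernel π) (β := β) hu D.γ_pos D.γ_lt_one
  refine le_trans ?_ hc
  have hs : 0 ≤ 1 - √D.γ :=
    sub_nonneg.2 (Real.sqrt_le_one.2 D.γ_lt_one.le)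
  have h1 := minEigenvalue_mul_norm_sq_le hm hφ β (v - ϑ)
  have h2 := integral_le_integral_occupancy (κ := D.stateActionKernel π) (β := β) hu.pow_two
    (fun x => sq_nonneg _) D.γ_pos.le D.γ_lt_one
  calc D.Gam φ β * ‖v - ϑ‖ ^ 2
      = (1 - √D.γ) * ((1 - D.γ) * (minEigenvalue (featureCovariance φ β) * ‖v - ϑ‖ ^ 2)) := by
        rw [Gam]; ring
    _ ≤ _ := mul_le_mul_of_nonneg_left
        ((mul_le_mul_of_nonneg_left h1 (sub_nonneg.2 D.γ_lt_one.le)).trans h2) hs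

lemma norm_tdStep_sq_le (hm : Measurable φ) (hφ : ∀ x, ‖φ x‖ ≤ 1) (hπ : π ∈ D.admissible)
    {ϑ : Vec N} (hϑ : ∀ x, D.qValue π x = linearQ φ ϑ x) {h : ℝ} (hh : 0 < h)
    (hh' : h ≤ D.Gam φ β / (2 * (1 + D.γ))) (v : Vec N) :
    ‖v - h • D.semiGradient φ β v π - ϑ‖ ^ 2 ≤ (1 - h * D.Gam φ β) * ‖v - ϑ‖ ^ 2 := by
  have hγ := D.γ_pos
  have hγ1 := D.γ_lt_one
  have hn := D.norm_semiGradient_le (β := β) hm hφ hπ hϑ v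
  have hc := D.coercive_semiGradient (β := β) hm hφ hπ hϑ v
  rw [le_div_iff₀ (by positivity)] at hh'
  rw [sub_right_comm, norm_sub_sq_real, inner_smul_right, norm_smul, mul_pow, Real.norm_eq_abs,
    sq_abs]
  have h1 : ‖D.semiGradient φ β v π‖ ^ 2 ≤ (1 + D.γ) ^ 2 * ‖v - ϑ‖ ^ 2 := by
    rw [← mul_pow]; exact pow_le_pow_left₀ (norm_nonneg _) hn 2
  -- As `1 + γ ≤ 2`, the step-size bound makes the quadratic term at most half of the descent `2hΓ`.
  have h2 : h ^ 2 * (1 + D.γ) ^ 2 ≤ h * D.Gam φ β := by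
    nlinarith [mul_le_mul_of_nonneg_left hh' hh.le, mul_pos (mul_pos hh hh) (by linarith : 0 < 1 + D.γ)]
  have h3 : h ^ 2 * ‖D.semiGradient φ β v π‖ ^ 2 ≤ h * D.Gam φ β * ‖v - ϑ‖ ^ 2 :=
    calc _ ≤ h ^ 2 * ((1 + D.γ) ^ 2 * ‖v - ϑ‖ ^ 2) :=
          mul_le_mul_of_nonneg_left h1 (sq_nonneg h)
      _ = h ^ 2 * (1 + D.γ) ^ 2 * ‖v - ϑ‖ ^ 2 := by ring
      _ ≤ _ := mul_le_mul_of_nonneg_right h2 (sq_nonneg _)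
  have h4 := mul_le_mul_of_nonneg_left hc hh.le
  linarith

lemma norm_tdIterate_sq_le (hm : Measurable φ) (hφ : ∀ x, ‖φ x‖ ≤ 1) (hπ : π ∈ D.admissible)
    {ϑ : Vec N} (hϑ : ∀ x, D.qValue π x = linearQ φ ϑ x) {h : ℝ} (hh : 0 < h)
    (hh' : h ≤ D.Gam φ β / (2 * (1 + D.γ))) (hh1 : h * D.Gam φ β ≤ 1) (v : Vec N) (k : ℕ) :
    ‖(fun w => w - h • D.semiGradient φ β w π)^[k] v - ϑ‖ ^ 2
      ≤ (1 - h * D.Gam φ β) ^ k * ‖v - ϑ‖ ^ 2 := by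
  induction k with
  | zero => simp
  | succ k ih =>
    rw [Function.iterate_succ_apply', pow_succ' (1 - h * D.Gam φ β), mul_assoc]
    exact (D.norm_tdStep_sq_le hm hφ hπ hϑ hh hh' _).trans
      (mul_le_mul_of_nonneg_left ih (sub_nonneg.2 hh1))

end MDP

/-! ### Two scalar recursions -/

/-- Take `M` to be the supremum, finite by assumption, and absorb `γ M` into the left side. -/
lemma le_div_of_forall_le_add_mul {S : Type*} {f : S → ℝ} (hf : BddAbove (Set.range f)) {c γ : ℝ}
    (h1 : γ < 1) (h : ∀ M, (∀ s, f s ≤ M) → ∀ s, f s ≤ c + γ * M) (s : S) :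
    f s ≤ c / (1 - γ) := by
  have : Nonempty S := ⟨s⟩
  have h2 : ⨆ s, f s ≤ c + γ * ⨆ s, f s := ciSup_le (h _ (le_ciSup hf))
  refine (le_ciSup hf s).trans ?_
  rw [le_div_iff₀ (sub_pos.2 h1)]
  linarith

/-- Discrete Grönwall: the product of the factors `1 + d k` is at most the exponential of the sum.
-/
lemma exists_le_of_le_one_add_mul {x d : ℕ → ℝ} (hx : ∀ n, 0 ≤ x n) (hd : ∀ n, 0 ≤ d n)
    (hs : Summable d) (h : ∀ n, x (n + 1) ≤ (1 + d n) * x n) : ∃ R, ∀ n, x n ≤ R := by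
  have key : ∀ n, x n ≤ Real.exp (∑ k ∈ Finset.range n, d k) * x 0 := by
    intro n
    induction n with
    | zero => simp
    | succ n ih =>
      rw [Finset.sum_range_succ, Real.exp_add, mul_comm (Real.exp _), mul_assoc]
      have h1 : 1 + d n ≤ Real.exp (d n) := by linarith [Real.add_one_le_exp (d n)]
      exact (h n).trans (mul_le_mul h1 ih (hx n) (Real.exp_pos _).le)
  exact ⟨Real.exp (∑' k, d k) * x 0, fun n => (key n).trans (mul_le_mul_of_nonneg_right
    (Real.exp_le_exp.2 (hs.sum_le_tsum _ fun k _ => hd k)) (hx 0))⟩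

/-! ### Approximate policy improvement and a priori bounds -/

namespace MDP

variable {S A : Type*} [MeasurableSpace S] [MeasurableSpace A] (D : MDP S A) {p q : Policy S A}
  {N : ℕ} {φ : S × A → Vec N}

/-- At `q` itself the objective vanishes: the advantage has mean zero and the penalty is zero. Since
`τ ≤ 1/λ`, the penalty at `p` dominates `τ KL(p|q)`, which turns the log-density of `q` into `τ
KL(p|μ)`. -/
lemma regularised_le_of_mirrorObjective_le (hm : Measurable φ) (hφ : ∀ x, ‖φ x‖ ≤ 1)
    (hp : p ∈ D.admissible) (hq : q ∈ D.admissible) {lam : ℝ} (hlam : 0 < lam)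
    (hlam' : D.τ * lam ≤ 1) {ϑ : Vec N} {s : S}
    (h : D.mirrorObjective φ lam p q ϑ s ≤ D.mirrorObjective φ lam q q ϑ s) :
    ∫ a, linearQ φ ϑ (s, a) ∂p.1 s + D.τ * D.kl p s
      ≤ ∫ a, linearQ φ ϑ (s, a) ∂q.1 s + D.τ * D.kl q s := by
  have hQ : BddMeas fun a => linearQ φ ϑ (s, a) := (bddMeas_linearQ hm hφ ϑ).comp (by fun_prop)
  obtain ⟨f, hfm, hfb, hf⟩ := hp
  obtain ⟨g, hgm, hgb, hg⟩ := hq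
  have hfs : BddMeas fun a => f (s, a) := BddMeas.comp ⟨hfm, hfb⟩ (by fun_prop)
  have hgs : BddMeas fun a => g (s, a) := BddMeas.comp ⟨hgm, hgb⟩ (by fun_prop)
  have hpac : p.1 s ≪ D.μ := hf s ▸ tilted_absolutelyContinuous _ _
  have hqac : q.1 s ≪ D.μ := hg s ▸ tilted_absolutelyContinuous _ _
  have hllr : ∀ ν : Measure A, IsProbabilityMeasure ν → ν ≪ D.μ →
      Integrable (llr (q.1 s) D.μ) ν := fun ν _ hν => by
    rw [hg s]; exact integrable_llr_tilted_self D.μ hgs ν hν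
  have hkq : D.kl q s = ∫ a, llr (q.1 s) D.μ a ∂q.1 s := by
    rw [kl, hg s]; exact toReal_klDiv_tilted_self D.μ hgs
  have hsum : ∀ ν : Measure A, IsProbabilityMeasure ν → ν ≪ D.μ →
      ∫ a, (linearQ φ ϑ (s, a) + D.τ * llr (q.1 s) D.μ a) ∂ν
        = ∫ a, linearQ φ ϑ (s, a) ∂ν + D.τ * ∫ a, llr (q.1 s) D.μ a ∂ν := fun ν hν' hν => by
    rw [integral_add (hQ.integrable ν) ((hllr ν hν' hν).const_mul _), integral_const_mul]
  have hadv : ∀ ν : Measure A, IsProbabilityMeasure ν → ν ≪ D.μ →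
      ∫ a, D.approxAdvantage φ ϑ q s a ∂ν
        = ∫ a, linearQ φ ϑ (s, a) ∂ν + D.τ * ∫ a, llr (q.1 s) D.μ a ∂ν
          - (∫ a, linearQ φ ϑ (s, a) ∂q.1 s + D.τ * D.kl q s) := fun ν hν' hν => by
    unfold approxAdvantage
    have hi : Integrable (fun a => linearQ φ ϑ (s, a) + D.τ * llr (q.1 s) D.μ a) ν :=
      (hQ.integrable ν).add ((hllr ν hν' hν).const_mul _)
    rw [integral_sub hi (integrable_const _), hsum ν hν' hν, hsum _ inferInstance hqac, hkq]
    simp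
  have hpq : (klDiv (p.1 s) (q.1 s)).toReal = D.kl p s - ∫ a, llr (q.1 s) D.μ a ∂p.1 s := by
    rw [kl, hf s, hg s]; exact toReal_klDiv_tilted_tilted D.μ hfs hgs
  unfold mirrorObjective at h
  rw [hadv _ inferInstance hpac, hadv _ inferInstance hqac, klDiv_self, ← hkq] at h
  have h1 : D.τ ≤ 1 / lam := (le_div_iff₀ hlam).2 hlam'
  have h2 := mul_le_mul_of_nonneg_right h1
    (ENNReal.toReal_nonneg (a := klDiv (p.1 s) (q.1 s)))
  have h3 : D.τ * (klDiv (p.1 s) (q.1 s)).toReal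
      = D.τ * D.kl p s - D.τ * ∫ a, llr (q.1 s) D.μ a ∂p.1 s := by rw [hpq]; ring
  simp only [ENNReal.toReal_zero, mul_zero, add_zero] at h
  linarith

lemma kl_nonneg (s : S) : 0 ≤ D.kl p s := ENNReal.toReal_nonneg

/-- Approximate policy improvement: a policy which improves the regularised one-step cost with
respect to an `ε`-approximation of `Q^q` has a value of at most `V^q + 2 ε / (1 - γ)`. -/
lemma value_le_of_regularised_le (hp : p ∈ D.admissible) (hq : q ∈ D.admissible)
    {f : S × A → ℝ} (hf : BddMeas f) {ε : ℝ} (hε : ∀ x, |f x - D.qValue q x| ≤ ε)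
    (h : ∀ s, ∫ a, f (s, a) ∂p.1 s + D.τ * D.kl p s ≤ ∫ a, f (s, a) ∂q.1 s + D.τ * D.kl q s)
    (s : S) : D.value p s ≤ D.value q s + 2 * ε / (1 - D.γ) := by
  have hVp := D.bddMeas_value hp
  have hVq := D.bddMeas_value hq
  have hQp := D.bddMeas_qValue hp
  have hQq := D.bddMeas_qValue hq
  have hslice : ∀ {u : S × A → ℝ} (_ : BddMeas u) (r : Policy S A) (s : S),
      Integrable (fun a => u (s, a)) (r.1 s) := fun hu r s =>
    (hu.comp (u := fun a => (s, a)) (by fun_prop)).integrable _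
  rw [← sub_le_iff_le_add']
  refine le_div_of_forall_le_add_mul (f := fun s => D.value p s - D.value q s) ?_ D.γ_lt_one
    (fun M hM s => ?_) s
  · obtain ⟨C, hC⟩ := (hVp.sub hVq).2
    exact ⟨C, by rintro _ ⟨s, rfl⟩; exact (le_abs_self _).trans (hC s)⟩
  -- One ε is paid in replacing the Q-function of `q` by `f` under `p`, and another in returning
  -- under `q` (`h6`); hence `2 ε + γ M`.
  · have h1 : ∀ x, D.qValue p x ≤ f x + (ε + D.γ * M) := fun x => by
      have h2 : ∫ s', D.value p s' ∂D.P x ≤ ∫ s', D.value q s' ∂D.P x + M := by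
        rw [← sub_le_iff_le_add', ← integral_sub (hVp.integrable _) (hVq.integrable _)]
        simpa using integral_mono ((hVp.sub hVq).integrable (D.P x)) (integrable_const M) hM
      have h3 := mul_le_mul_of_nonneg_left h2 D.γ_pos.le
      have h4 := (abs_le.1 (hε x)).1
      unfold qValue at h4 ⊢
      linarith
    have h5 : ∫ a, D.qValue p (s, a) ∂p.1 s ≤ ∫ a, f (s, a) ∂p.1 s + (ε + D.γ * M) := by
      have := integral_mono (hslice hQp p s) ((hslice hf p s).add (integrable_const (ε + D.γ * M)))
        fun a => h1 (s, a)
      simp only [Pi.add_apply] at this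
      rw [integral_add (hslice hf p s) (integrable_const _)] at this
      simpa using this
    have h6 : ∫ a, f (s, a) ∂q.1 s ≤ ∫ a, D.qValue q (s, a) ∂q.1 s + ε := by
      have := integral_mono (hslice hf q s) ((hslice hQq q s).add (integrable_const ε))
        fun a => show f (s, a) ≤ D.qValue q (s, a) + ε by linarith [(abs_le.1 (hε (s, a))).2]
      simp only [Pi.add_apply] at this
      rw [integral_add (hslice hQq q s) (integrable_const _)] at this
      simpa using this
    have h7 := h s
    rw [D.value_eq hp, D.value_eq hq]
    linarith

lemma neg_div_le_value (hp : p ∈ D.admissible) {C : ℝ} (hC : ∀ x, |D.cost x| ≤ C) (s : S) :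
    -(C / (1 - D.γ)) ≤ D.value p s := by
  have hV := D.bddMeas_value hp
  have hQ := D.bddMeas_qValue hp
  rw [neg_le]
  refine le_div_of_forall_le_add_mul (f := fun s => -D.value p s) ?_ D.γ_lt_one
    (fun M hM s => ?_) s
  · obtain ⟨B, hB⟩ := hV.2
    exact ⟨B, by rintro _ ⟨s, rfl⟩; exact (neg_le_abs _).trans (hB s)⟩
  · have h1 : ∀ x, -(C + D.γ * M) ≤ D.qValue p x := fun x => by
      have h2 : -M ≤ ∫ s', D.value p s' ∂D.P x := by
        simpa using integral_mono (integrable_const (-M)) (hV.integrable (D.P x))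
          fun s => neg_le.1 (hM s)
      have h3 := mul_le_mul_of_nonneg_left h2 D.γ_pos.le
      have h4 := (abs_le.1 (hC x)).1
      unfold qValue
      linarith
    have h5 : -(C + D.γ * M) ≤ ∫ a, D.qValue p (s, a) ∂p.1 s := by
      simpa using integral_mono (integrable_const (-(C + D.γ * M)))
        ((hQ.comp (u := fun a => (s, a)) (by fun_prop)).integrable (p.1 s)) fun a => h1 (s, a)
    have h6 := mul_nonneg D.τ_pos.le (D.kl_nonneg (p := p) s)
    rw [D.value_eq hp]
    linarith

lemma abs_qValue_le {C B : ℝ} (hC : ∀ x, |D.cost x| ≤ C) (hB : ∀ s, |D.value p s| ≤ B)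
    (x : S × A) : |D.qValue p x| ≤ C + B := by
  refine (abs_add_le _ _).trans (add_le_add (hC x) ?_)
  rw [abs_mul, abs_of_pos D.γ_pos]
  exact (mul_le_mul D.γ_lt_one.le (BddMeas.abs_integral_le hB _) (abs_nonneg _)
    zero_le_one).trans_eq (one_mul B)

lemma kl_le (hp : p ∈ D.admissible) {C B : ℝ} (hC : ∀ x, |D.cost x| ≤ C)
    (hB : ∀ s, |D.value p s| ≤ B) (s : S) : D.kl p s ≤ (C + 2 * B) / D.τ := by
  rw [le_div_iff₀ D.τ_pos]
  have h1 := BddMeas.abs_integral_le (fun a => D.abs_qValue_le hC hB (s, a)) (p.1 s)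
  have h2 := D.value_eq hp s
  have h3 := (abs_le.1 (hB s)).2
  have h4 := (abs_le.1 h1).1
  linarith

lemma norm_param_le (hm : Measurable φ) (hφ : ∀ x, ‖φ x‖ ≤ 1) (β : Measure (S × A))
    [IsProbabilityMeasure β] (hβ : 0 < minEigenvalue (featureCovariance φ β)) {ϑ : Vec N} {B : ℝ}
    (hB : ∀ x, |linearQ φ ϑ x| ≤ B) (hB0 : 0 ≤ B) :
    ‖ϑ‖ ≤ (√(minEigenvalue (featureCovariance φ β)))⁻¹ * B := by
  set l := minEigenvalue (featureCovariance φ β)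
  have h1 : l * ‖ϑ‖ ^ 2 ≤ ∫ x, linearQ φ ϑ x ^ 2 ∂β := minEigenvalue_mul_norm_sq_le hm hφ β ϑ
  have h2 : ∫ x, linearQ φ ϑ x ^ 2 ∂β ≤ B ^ 2 := by
    simpa using integral_mono ((bddMeas_linearQ hm hφ ϑ).pow_two.integrable β)
      (integrable_const (B ^ 2)) fun x => sq_le_sq.2 ((hB x).trans (le_abs_self B))
  have hl : 0 < √l := Real.sqrt_pos.2 hβ
  rw [← div_eq_inv_mul, le_div_iff₀ hl]
  refine abs_le_of_sq_le_sq' ?_ hB0 |>.2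
  rw [mul_pow, Real.sq_sqrt hβ.le]
  linarith

lemma klDiv_eq_ofReal_kl (hp : p ∈ D.admissible) (s : S) :
    klDiv (p.1 s) D.μ = ENNReal.ofReal (D.kl p s) := by
  obtain ⟨f, hfm, hfb, hf⟩ := hp
  rw [kl, ENNReal.ofReal_toReal]
  rw [hf s]
  exact klDiv_tilted_self_ne_top D.μ (BddMeas.comp ⟨hfm, hfb⟩ (by fun_prop))

end MDP

/-- Use `1 - a ≤ exp (-a)`. The constant 4 gives a fourth power because the contraction is of
squared errors; the error itself then gains the summable factor `(κ(n+1))⁻²`. -/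
lemma one_sub_pow_le_of_log_le {a κ : ℝ} (ha : 0 < a) (ha1 : a ≤ 1) (hκ : 0 < κ) {n m : ℕ}
    (hm : 4 / a * Real.log (κ * ((n : ℝ) + 1)) ≤ m) :
    (1 - a) ^ m ≤ ((κ * ((n : ℝ) + 1))⁻¹ ^ 2) ^ 2 := by
  have hpos : 0 < κ * ((n : ℝ) + 1) := by positivity
  have h1 : 1 - a ≤ Real.exp (-a) := by linarith [Real.add_one_le_exp (-a)]
  calc (1 - a) ^ m ≤ Real.exp (-a) ^ m := pow_le_pow_left₀ (sub_nonneg.2 ha1) h1 m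
    _ = Real.exp (-(a * m)) := by rw [← Real.exp_nat_mul]; ring_nf
    _ ≤ Real.exp (-(4 * Real.log (κ * ((n : ℝ) + 1)))) := by
        refine Real.exp_le_exp.2 (neg_le_neg ?_)
        have := mul_le_mul_of_nonneg_left hm ha.le
        rwa [← mul_assoc, mul_div_cancel₀ _ ha.ne'] at this
    _ = ((κ * ((n : ℝ) + 1))⁻¹ ^ 2) ^ 2 := by
        rw [Real.exp_neg, ← pow_mul, inv_pow]
        congr 1
        rw [← Real.exp_log hpos, ← Real.exp_nat_mul, Real.log_exp]
        norm_num

lemma summable_inv_mul_sq (κ : ℝ) : Summable fun n : ℕ => (κ * ((n : ℝ) + 1))⁻¹ ^ 2 := by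
  have h := ((summable_nat_add_iff 1).2 (Real.summable_one_div_nat_pow.2 one_lt_two)).mul_left
    (κ⁻¹ ^ 2)
  refine h.congr fun n => ?_
  push_cast
  rw [mul_inv, mul_pow, one_div, inv_pow (_ + 1)]

end

end EntropyMDP

/-! ### Closing the actor-critic feedback loop -/

theorem mainTheorem3
    {S A : Type*}
    [TopologicalSpace S] [PolishSpace S] [MeasurableSpace S] [BorelSpace S]
    [TopologicalSpace A] [PolishSpace A] [MeasurableSpace A] [BorelSpace A]
    (D : EntropyMDP.MDP S A)
    {N : ℕ} (φ : S × A → EntropyMDP.Vec N) (hφ_meas : Measurable φ)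
    (β : Measure (S × A)) [IsProbabilityMeasure β]
    (ρ : Measure S) [IsProbabilityMeasure ρ]
    (hβ : 0 < EntropyMDP.minEigenvalue (EntropyMDP.featureCovariance φ β))
    (hφ : ∀ x, ‖φ x‖ ≤ 1)
    (hQ : D.Realisable φ)
    (h lam : ℝ) (hh : 0 < h)
    (hh' : h < min (D.Gam φ β / (2 * (1 + D.γ))) (1 / D.Gam φ β))
    (hlam : 0 < D.τ * lam) (hlam' : D.τ * lam < 1)
    (κ : ℝ) (hκ : 0 < κ)
    (M : ℕ → ℕ) (hM1 : ∀ n, 1 ≤ M n)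
    (hM : ∀ n : ℕ, 4 / (h * D.Gam φ β) * Real.log (κ * ((n : ℝ) + 1)) ≤ (M n : ℝ))
    (θ : ℕ → EntropyMDP.Vec N) (π : ℕ → EntropyMDP.Policy S A)
    (hrun : D.IsDoubleLoopRun φ β ρ h lam M θ π) :
    ∃ R : ℝ, 0 ≤ R ∧ ∀ (n : ℕ) (s : S),
      ENNReal.ofReal ‖θ n‖ + klDiv ((π n).1 s) D.μ ≤ ENNReal.ofReal R := by
  have hγ1 : 0 < 1 - D.γ := sub_pos.2 D.γ_lt_one
  have hΓ : 0 < D.Gam φ β := mul_pos (mul_pos hγ1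
    (sub_pos.2 ((Real.sqrt_lt' one_pos).2 (by simpa using D.γ_lt_one)))) hβ
  have hstep := (hh'.trans_le (min_le_left _ _)).le
  have hstep1 : h * D.Gam φ β ≤ 1 :=
    ((lt_div_iff₀ hΓ).1 (hh'.trans_le (min_le_right _ _))).le
  have hlam0 : 0 < lam := (mul_pos_iff_of_pos_left D.τ_pos).1 hlam
  have hadm : ∀ n, π n ∈ D.admissible
    | 0 => hrun.init
    | n + 1 => (hrun.actor n).mem
  choose ϑ hϑ using fun n => hQ (π n) (hadm n)
  obtain ⟨C', hC'⟩ := D.bounded_cost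
  set C := |C'|
  have hC : ∀ x, |D.cost x| ≤ C := fun x => (hC' x).trans (le_abs_self _)
  have hC0 : 0 ≤ C := abs_nonneg _
  obtain ⟨B₀, hB₀⟩ := (D.bddMeas_value (hadm 0)).2
  set ε : ℕ → ℝ := fun n => ‖θ (n + 1) - ϑ n‖ with hε
  set a : ℝ := 2 / (1 - D.γ) with ha
  have ha0 : 0 ≤ a := by positivity
  -- Bound for `|V^n|`: the initial bound plus accumulated improvement errors. The maximum with `C /
  -- (1 - γ)` covers the lower bound.
  set b : ℕ → ℝ := fun n => max B₀ (C / (1 - D.γ)) + ∑ k ∈ Finset.range n, a * ε k with hb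
  have hε0 : ∀ n, 0 ≤ ε n := fun n => norm_nonneg _
  have hbs : ∀ n, b (n + 1) = b n + a * ε n := fun n => by
    simp only [hb, Finset.sum_range_succ, add_assoc]
  have hbC : ∀ n, C / (1 - D.γ) ≤ b n := fun n =>
    (le_max_right _ _).trans (le_add_of_nonneg_right
      (Finset.sum_nonneg fun k _ => mul_nonneg ha0 (hε0 k)))
  have hb0 : ∀ n, 0 ≤ b n := fun n => (div_nonneg hC0 hγ1.le).trans (hbC n)
  have hV : ∀ n s, |D.value (π n) s| ≤ b n := by
    intro n
    induction n with
    | zero => exact fun s => (hB₀ s).trans (by simp [hb])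
    | succ n ih =>
      intro s
      refine abs_le.2 ⟨(neg_le_neg (hbC _)).trans (D.neg_div_le_value (hadm _) hC s), ?_⟩
      have himp := D.value_le_of_regularised_le (hadm (n + 1)) (hadm n)
        (EntropyMDP.bddMeas_linearQ hφ_meas hφ (θ (n + 1))) (ε := ε n)
        (fun x => by rw [hϑ n x, ← EntropyMDP.linearQ_sub]; exact EntropyMDP.abs_linearQ_le hφ _ x)
        (fun s => D.regularised_le_of_mirrorObjective_le hφ_meas hφ (hadm _) (hadm _) hlam0
          hlam'.le ((hrun.actor n).pointwise _ (hadm n) s)) s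
      have e : 2 * ε n / (1 - D.γ) = a * ε n := by rw [ha]; ring
      rw [hbs, ← e]
      linarith [(abs_le.1 (ih s)).2]
  set K := (√(EntropyMDP.minEigenvalue (EntropyMDP.featureCovariance φ β)))⁻¹
  have hK0 : 0 ≤ K := inv_nonneg.2 (Real.sqrt_nonneg _)
  have hϑn : ∀ n, ‖ϑ n‖ ≤ K * (C + b n) := fun n =>
    EntropyMDP.MDP.norm_param_le hφ_meas hφ β hβ
      (fun x => by rw [← hϑ n x]; exact D.abs_qValue_le hC (hV n) x)
      (add_nonneg hC0 (hb0 n))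
  set c : ℕ → ℝ := fun n => (κ * ((n : ℝ) + 1))⁻¹ ^ 2 with hc
  have hc0 : ∀ n, 0 ≤ c n := fun n => sq_nonneg _
  have hεc : ∀ n, ε n ≤ c n * ‖θ n - ϑ n‖ := fun n => by
    have h1 := D.norm_tdIterate_sq_le hφ_meas hφ (hadm n) (hϑ n) hh hstep hstep1 (θ n) (M n)
    rw [← hrun.critic n] at h1
    have h2 := mul_le_mul_of_nonneg_right
      (EntropyMDP.one_sub_pow_le_of_log_le (mul_pos hh hΓ) hstep1 hκ (hM n)) (sq_nonneg ‖θ n - ϑ n‖)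
    refine (abs_le_of_sq_le_sq' ?_ (mul_nonneg (hc0 n) (norm_nonneg _))).2
    rw [mul_pow]
    exact h1.trans h2
  -- This quantity dominates `ε n` and, up to the factor `K`, both `‖ϑ n‖` and `‖ϑ (n+1)‖`, so it
  -- controls the critic's next initial error.
  set x : ℕ → ℝ := fun n => C + b (n + 1) + ε n with hx
  have hx0 : ∀ n, 0 ≤ x n := fun n => add_nonneg (add_nonneg hC0 (hb0 _)) (hε0 n)
  have hrec : ∀ n, x (n + 1) ≤ (1 + (1 + a) * (1 + 2 * K) * c (n + 1)) * x n := fun n => by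
    have h1 : ‖θ (n + 1) - ϑ (n + 1)‖ ≤ (1 + 2 * K) * x n := by
      have h2 : ‖θ (n + 1) - ϑ (n + 1)‖ ≤ ε n + (‖ϑ n‖ + ‖ϑ (n + 1)‖) := by
        have e : θ (n + 1) - ϑ (n + 1) = (θ (n + 1) - ϑ n) + (ϑ n - ϑ (n + 1)) := by abel
        rw [e]
        exact (norm_add_le _ _).trans (add_le_add_right (norm_sub_le _ _) _)
      have h3 : b n ≤ b (n + 1) := by rw [hbs]; linarith [mul_nonneg ha0 (hε0 n)]
      have h4 : ‖ϑ n‖ ≤ K * x n := (hϑn n).trans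
        (mul_le_mul_of_nonneg_left (by simp only [hx]; linarith [hε0 n]) hK0)
      have h5 : ‖ϑ (n + 1)‖ ≤ K * x n := (hϑn (n + 1)).trans
        (mul_le_mul_of_nonneg_left (by simp only [hx]; linarith [hε0 n]) hK0)
      have h6 : ε n ≤ x n := by simp only [hx]; linarith [hb0 (n + 1)]
      linarith
    have h7 : ε (n + 1) ≤ c (n + 1) * ((1 + 2 * K) * x n) :=
      (hεc (n + 1)).trans (mul_le_mul_of_nonneg_left h1 (hc0 _))
    have h8 := mul_le_mul_of_nonneg_left h7 (add_nonneg zero_le_one ha0)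
    have h9 : x (n + 1) = C + b (n + 1) + (1 + a) * ε (n + 1) := by
      simp only [hx, hbs (n + 1)]; ring
    have h10 : C + b (n + 1) ≤ x n := by simp only [hx]; linarith [hε0 n]
    rw [h9]
    linarith
  obtain ⟨R, hR⟩ := EntropyMDP.exists_le_of_le_one_add_mul hx0
    (fun n => mul_nonneg (by positivity) (hc0 (n + 1)))
    (((summable_nat_add_iff 1).2 (EntropyMDP.summable_inv_mul_sq κ)).mul_left _) hrec
  have hR0 : 0 ≤ R := (hx0 0).trans (hR 0)
  have hbR : ∀ n, b n ≤ R := fun n => by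
    refine le_trans ?_ (hR n)
    simp only [hx, hbs]
    linarith [hε0 n, mul_nonneg ha0 (hε0 n)]
  -- The recursion only controls `θ (n+1)`; the arbitrary `θ 0` is added separately.
  have hθR : ∀ n, ‖θ n‖ ≤ ‖θ 0‖ + (R + K * (C + R))
    | 0 => le_add_of_nonneg_right (by positivity)
    | n + 1 => by
      have h1 : ‖θ (n + 1)‖ ≤ ε n + ‖ϑ n‖ := by
        simpa using norm_add_le (θ (n + 1) - ϑ n) (ϑ n)
      have h2 : ε n ≤ R := le_trans (by simp only [hx]; linarith [hb0 (n + 1)]) (hR n)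
      have h3 := (hϑn n).trans (mul_le_mul_of_nonneg_left (add_le_add_right (hbR n) C) hK0)
      linarith [norm_nonneg (θ 0)]
  have hτ := D.τ_pos
  refine ⟨‖θ 0‖ + (R + K * (C + R)) + (C + 2 * R) / D.τ, by positivity, fun n s => ?_⟩
  rw [D.klDiv_eq_ofReal_kl (hadm n), ← ENNReal.ofReal_add (norm_nonneg _) (D.kl_nonneg s)]
  exact ENNReal.ofReal_le_ofReal (add_le_add (hθR n)
    (D.kl_le (hadm n) hC (fun s => (hV n s).trans (hbR n)) s))
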